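/- **Model.** Let $\mathcal P$ be a finite set of processes, with a unidirectional channel $(p,q)$ for every pair $p,q\in\mathcal P$. The system is asynchronous and message-passing. Processes may crash, and a process is correct in an execution if it never crashes. A channel may disconnect, after which it drops all messages sent through it; messages sent by a correct process to a correct process through a channel that has not disconnected are eventually delivered. A failure pattern is a pair $f=(P,C)$ with $P\subseteq\mathcal P$ and $C\subseteq\mathcal P\times\mathcal P$, where $(p,q)\in C$ implies $p,q\notin P$. An execution is $f$-compliant if only processes in $P$ crash and only channels in $C$ disconnect in it, and fair if every correct process takes infinitely many steps in it. A fail-prone system $\mathcal F$ is a set of failure patterns. The residual graph $\mathcal G\setminus f$ has vertex set $\mathcal P\setminus P$ and as edges all channels between these vertices that are not in $C$. **Generalized quorum systems.** For $\mathcal R,\mathcal W\subseteq 2^{\mathcal P}$, the triple $(\mathcal F,\mathcal R,\mathcal W)$ is a generalized quorum system if (Consistency) $R\cap W\ne\emptyset$ for all $R\in\mathcal R$, $W\in\mathcal W$, and (Availability) for every $f=(P,C)\in\mathcal F$ there are $W\in\mathcal W$ and $R\in\mathcal R$ such that $W$ is $f$-available, i.e. $W\subseteq\mathcal P\setminus P$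 and $W$ is strongly connected in $\mathcal G\setminus f$, and $W$ is $f$-reachable from $R$, i.e. $R,W\subseteq\mathcal P\setminus P$ and every member of $W$ can be reached from every member of $R$ by a directed path in $\mathcal G\setminus f$. In that case $U_f$ denotes the strongly connected component of $\mathcal G\setminus f$ that contains all $W\in\mathcal W$ which are $f$-available and $f$-reachable from some $R\in\mathcal R$. **Objects.** (i) A multi-writer multi-reader (MWMR) atomic register over a set of values with at least two elements, with any initial value: linearizable reads and writes. (ii) A single-writer multi-reader (SWMR) atomic snapshot object over such a set of values, with any initial values: one segment per process, a write by a process sets its own segment and a read returns the vector of all segments; linearizable. In (i) and (ii) a process invokes an operation only after its previous one has returned. (iii) Single-shot lattice agreement over a join-semilattice $L$ that contains two incomparable elements: each process $p_i$ invokes $\mathsf{propose}(x_i)$, $x_i\in L$, at most once; returned values $y_i$ must satisfy $y_i\le y_j$ or $y_j\le y_i$ for all $i,j$, $x_i\le y_i$, and $y_i\le\bigsqcup X$, where $X$ is the set of all proposed values. Safety is required in all executions. **Liveness.** Let $\tau:\mathcal F\to 2^{\mathcal P}$ map each $f=(P,C)\in\mathcal F$ to a subset of $\mathcal P\setminus P$.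 An operation $op$ eventually executes solo in an execution $\sigma$ if $\sigma$ has a suffix in which all other operations in progress that are concurrent with $op$ are invoked by processes that are faulty in $\sigma$. An implementation is $(\mathcal F,\tau)$-obstruction-free if for every $f\in\mathcal F$ and every $f$-compliant fair execution $\sigma$, every operation that is invoked in $\sigma$ by a process in $\tau(f)$ and eventually executes solo returns. **Theorem 4.2.** Suppose that $\tau(f)\ne\emptyset$ for every $f\in\mathcal F$ and that there exists an $(\mathcal F,\tau)$-obstruction-free implementation of any of the following objects: MWMR atomic registers, SWMR atomic snapshots, or lattice agreement. Then there exist $\mathcal R$ and $\mathcal W$ such that $(\mathcal F,\mathcal R,\mathcal W)$ is a generalized quorum system and, moreover, $\tau(f)\subseteq U_f$ for each $f\in\mathcal F$. -/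

import Mathlib

universe u v v' w

/-! ## Failure patterns and generalized quorum systems

A channel is an ordered pair of processes; there is one for every pair. -/

/-- A failure pattern: the processes and the channels that are allowed to fail. Only channels
between correct processes are listed; channels incident to faulty processes count as faulty by
default. -/
structure FailurePattern (Proc : Type u) where
  procs : Set Proc
  chans : Set (Proc × Proc)
  chans_correct : ∀ p q, (p, q) ∈ chans → p ∉ procs ∧ q ∉ procs

namespace FailurePattern

variable {Proc : Type u}

/-- The edges of the residual graph: the channels between correct processes that may not fail. -/
def Edge (f : FailurePattern Proc) (p q : Proc) : Prop :=
  p ∉ f.procs ∧ q ∉ f.procs ∧ (p, q) ∉ f.chans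

/-- There is a (possibly empty) directed path from `p` to `q` in the residual graph. -/
def Reach (f : FailurePattern Proc) (p q : Proc) : Prop :=
  Relation.ReflTransGen f.Edge p q

/-- `Q` is `f`-available: its members are correct and strongly connected in the residual graph. -/
def Available (f : FailurePattern Proc) (Q : Set Proc) : Prop :=
  Q ⊆ f.procsᶜ ∧ ∀ p ∈ Q, ∀ q ∈ Q, f.Reach p q

/-- `W` is `f`-reachable from `R`. -/
def ReachableFrom (f : FailurePattern Proc) (W R : Set Proc) : Prop :=
  W ⊆ f.procsᶜ ∧ R ⊆ f.procsᶜ ∧ ∀ r ∈ R, ∀ q ∈ W, f.Reach r q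

/-- The union of all write quorums that validate availability with respect to `f`. -/
def validating (f : FailurePattern Proc) (Rs Ws : Set (Set Proc)) : Set Proc :=
  ⋃₀ {W | W ∈ Ws ∧ f.Available W ∧ ∃ R ∈ Rs, f.ReachableFrom W R}

/-- The set `U_f`: the strongly connected component of the residual graph that contains
`f.validating Rs Ws` (for a generalized quorum system that set is non-empty and strongly
connected, so it lies in exactly one component). -/
def component (f : FailurePattern Proc) (Rs Ws : Set (Set Proc)) : Set Proc :=
  {p | ∃ q ∈ f.validating Rs Ws, f.Reach p q ∧ f.Reach q p}

end FailurePattern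

/-- Generalized quorum systems. -/
structure IsGQS {Proc : Type u} (F : Set (FailurePattern Proc)) (Rs Ws : Set (Set Proc)) :
    Prop where
  consistency : ∀ R ∈ Rs, ∀ W ∈ Ws, (R ∩ W).Nonempty
  availability : ∀ f ∈ F, ∃ W ∈ Ws, ∃ R ∈ Rs, f.Available W ∧ f.ReachableFrom W R

/-! ## Asynchronous message-passing algorithms and their executions -/

/-- What triggers an action of a process: the invocation of an operation by its client, the receipt
of a message `m` sent by `q`, or nothing (a spontaneous local step). -/
inductive Input (Proc : Type u) (Op : Type v) (Msg : Type w) where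
  | invoke (o : Op)
  | receive (q : Proc) (m : Msg)
  | tick

/-- A (possibly non-deterministic) algorithm. In one action a process reads its local state and the
input, and then moves to a new local state, sends finitely many messages, and possibly returns
a response to its client. `total` says that an action is never blocked. -/
structure Algorithm (Proc : Type u) (Op : Type v) (Resp : Type v') where
  State : Type w
  Msg : Type w
  start : Proc → State
  trans : Proc → State → Input Proc Op Msg → Set (State × List (Proc × Msg) × Option Resp)
  total : ∀ p s i, (trans p s i).Nonempty

/-- The events of an execution. `act p i r` is an action of `p` triggered by `i`, where `r` is the
response returned in this action, if any. -/
inductive Event (Proc : Type u) (Op : Type v) (Resp : Type v') (Msg : Type w) where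
  | act (p : Proc) (i : Input Proc Op Msg) (r : Option Resp)
  | crash (p : Proc)
  | disconnect (p q : Proc)

namespace Algorithm

variable {Proc : Type u} {Op : Type v} {Resp : Type v'}

/-- A global configuration. `net` holds the messages in transit, as triples (sender, receiver,
content). -/
structure Config (A : Algorithm.{u, v, v', w} Proc Op Resp) where
  state : Proc → A.State
  net : Multiset (Proc × Proc × A.Msg)
  crashed : Set Proc
  down : Set (Proc × Proc)

/-- The initial configuration: nothing in transit, nothing failed. -/
def initial (A : Algorithm.{u, v, v', w} Proc Op Resp) : A.Config :=
  ⟨A.start, 0, ∅, ∅⟩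

/-- The input `i` of an action of `p` is available when `N` is in transit, and `N'` remains in
transit after it is consumed. -/
def Consumes (A : Algorithm.{u, v, v', w} Proc Op Resp) (p : Proc) :
    Input Proc Op A.Msg → Multiset (Proc × Proc × A.Msg) → Multiset (Proc × Proc × A.Msg) → Prop
  | .receive q m, N, N' => N = (q, p, m) ::ₘ N'
  | _, N, N' => N = N'

open Classical in
/-- The messages that enter the network when `p` sends `out`: those sent through a disconnected
channel are dropped. -/
noncomputable def sent (A : Algorithm.{u, v, v', w} Proc Op Resp) (down : Set (Proc × Proc)) (p : Proc)
    (out : List (Proc × A.Msg)) : Multiset (Proc × Proc × A.Msg) :=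
  ((out.filter fun x => (p, x.1) ∉ down).map fun x => (p, x.1, x.2) : List _)

open Classical in
/-- The transitions of the system. Channels need not be FIFO. -/
inductive Step (A : Algorithm.{u, v, v', w} Proc Op Resp) :
    A.Config → Event Proc Op Resp A.Msg → A.Config → Prop
  | act (c : A.Config) (p : Proc) (i : Input Proc Op A.Msg) (N : Multiset (Proc × Proc × A.Msg))
      (s : A.State) (out : List (Proc × A.Msg)) (r : Option Resp)
      (alive : p ∉ c.crashed) (input : A.Consumes p i c.net N)
      (tr : (s, out, r) ∈ A.trans p (c.state p) i) :
      Step A c (.act p i r)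
        { c with state := Function.update c.state p s, net := N + A.sent c.down p out }
  | crash (c : A.Config) (p : Proc) :
      Step A c (.crash p) { c with crashed := insert p c.crashed }
  | disconnect (c : A.Config) (p q : Proc) :
      Step A c (.disconnect p q) { c with down := insert (p, q) c.down }

/-- Executions, finite or infinite. At each instant at most one event occurs; `ev t = none` means
that nothing happens at instant `t`, so a finite execution is one without events from some instant
on. -/
structure Execution (A : Algorithm.{u, v, v', w} Proc Op Resp) where
  conf : ℕ → A.Config
  ev : ℕ → Option (Event Proc Op Resp A.Msg)
  conf_zero : conf 0 = A.initial
  next : ∀ t, (ev t = none ∧ conf (t + 1) = conf t) ∨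
    ∃ a, ev t = some a ∧ A.Step (conf t) a (conf (t + 1))

end Algorithm

/-! ## Histories and operations -/

/-- What a client of `proc` sees in one action: the operation invoked, if any, and the response
returned, if any. -/
structure HistEntry (Proc : Type u) (Op : Type v) (Resp : Type v') where
  proc : Proc
  inv : Option Op
  resp : Option Resp

/-- The part of an execution that is visible to the clients. -/
abbrev History (Proc : Type u) (Op : Type v) (Resp : Type v') := ℕ → Option (HistEntry Proc Op Resp)

namespace History

variable {Proc : Type u} {Op : Type v} {Resp : Type v'}

/-- Operation `o` is invoked by `p` at instant `t`. An operation is identified by the instant of its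
invocation. -/
def Invokes (h : History Proc Op Resp) (t : ℕ) (p : Proc) (o : Op) : Prop :=
  ∃ e, h t = some e ∧ e.proc = p ∧ e.inv = some o

/-- `p` returns response `r` at instant `t`. -/
def Responds (h : History Proc Op Resp) (t : ℕ) (p : Proc) (r : Resp) : Prop :=
  ∃ e, h t = some e ∧ e.proc = p ∧ e.resp = some r

/-- The operation invoked at instant `t` returns at instant `t'` with `r`: this is the first
response at its process since the invocation. -/
def Returns (h : History Proc Op Resp) (t t' : ℕ) (r : Resp) : Prop :=
  ∃ p o, h.Invokes t p o ∧ t ≤ t' ∧ h.Responds t' p r ∧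
    ∀ s, t ≤ s → s < t' → ∀ r', ¬ h.Responds s p r'

/-- The operation invoked at `t'` follows the one invoked at `t`. -/
def Precedes (h : History Proc Op Resp) (t t' : ℕ) : Prop :=
  ∃ s r, h.Returns t s r ∧ s < t'

/-- The operations invoked at `t` and `t'` are concurrent. -/
def Concurrent (h : History Proc Op Resp) (t t' : ℕ) : Prop :=
  ¬ h.Precedes t t' ∧ ¬ h.Precedes t' t

/-- The clients are sequential: a process invokes an operation only after its previous one has
returned. -/
def Sequential (h : History Proc Op Resp) : Prop :=
  ∀ p t t' o o', t < t' → h.Invokes t p o → h.Invokes t' p o' →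
    ∃ s r, t ≤ s ∧ s < t' ∧ h.Responds s p r

/-- Every process invokes at most one operation. -/
def SingleShot (h : History Proc Op Resp) : Prop :=
  ∀ p t t' o o', h.Invokes t p o → h.Invokes t' p o' → t = t'

end History

/-- An operation (with the instant of its invocation) paired with a response. -/
structure OpRecord (Proc : Type u) (Op : Type v) (Resp : Type v') where
  time : ℕ
  proc : Proc
  op : Op
  resp : Resp

/-- A sequential execution, finite or infinite; slots holding `none` are to be skipped. -/
abbrev SeqExec (Proc : Type u) (Op : Type v) (Resp : Type v') := ℕ → Option (OpRecord Proc Op Resp)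

/-- `h` is linearizable with respect to the set `correct` of correct sequential executions: there is
a sequence `π` of all complete operations and some incomplete ones, the latter paired with arbitrary
responses, that is a correct sequential execution and respects the real-time order. -/
def Linearizable {Proc : Type u} {Op : Type v} {Resp : Type v'} (correct : SeqExec Proc Op Resp → Prop)
    (h : History Proc Op Resp) : Prop :=
  ∃ π : SeqExec Proc Op Resp,
    (∀ i a, π i = some a → h.Invokes a.time a.proc a.op ∧
      ∀ t r, h.Returns a.time t r → a.resp = r) ∧
    (∀ t t' r, h.Returns t t' r → ∃ i a, π i = some a ∧ a.time = t) ∧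
    (∀ i j a b, π i = some a → π j = some b → a.time = b.time → i = j) ∧
    (∀ i j a b, π i = some a → π j = some b → h.Precedes a.time b.time → i < j) ∧
    correct π

/-! ## Objects -/

/-- An object: `usage` says which histories its clients may generate, `safety` is the safety
specification. -/
structure ObjectSpec (Proc : Type u) (Op : Type v) (Resp : Type v') where
  usage : History Proc Op Resp → Prop
  safety : History Proc Op Resp → Prop

/-- Operations of registers and of snapshot objects. -/
inductive RWOp (Value : Type v) where
  | read
  | write (x : Value)

/-- Responses of registers and of snapshot objects; `α` is the type of what a read returns. -/
inductive RWResp (α : Type v) where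
  | ack
  | val (a : α)

/-- `a` is a write by a process in `S`. -/
def OpRecord.IsWriteBy {Proc : Type u} {Value : Type v} {Resp : Type v'} (S : Set Proc)
    (a : OpRecord Proc (RWOp Value) Resp) : Prop :=
  a.proc ∈ S ∧ ∃ x, a.op = .write x

/-- `x` is the value written by the most recent write by a process in `S` before slot `i` of `π`,
or the initial value `x₀` if there is no such write. -/
def LastWritten {Proc : Type u} {Value : Type v} {Resp : Type v'} (S : Set Proc) (x₀ : Value)
    (π : SeqExec Proc (RWOp Value) Resp) (i : ℕ) (x : Value) : Prop :=
  (∃ j < i, ∃ a, π j = some a ∧ a.proc ∈ S ∧ a.op = .write x ∧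
    ∀ k, j < k → k < i → ∀ b, π k = some b → ¬ b.IsWriteBy S) ∨
  (x = x₀ ∧ ∀ k < i, ∀ b, π k = some b → ¬ b.IsWriteBy S)

/-- Correct sequential executions of a register with initial value `x₀`. -/
def RegisterCorrect {Proc : Type u} {Value : Type v} (x₀ : Value)
    (π : SeqExec Proc (RWOp Value) (RWResp Value)) : Prop :=
  ∀ i a, π i = some a →
    (∀ x, a.op = .write x → a.resp = .ack) ∧
    (a.op = .read → ∃ x, a.resp = .val x ∧ LastWritten Set.univ x₀ π i x)

/-- Correct sequential executions of a single-writer snapshot object, whose segments are indexed by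
the processes; `x₀ q` is the initial value of the segment of `q`. -/
def SnapshotCorrect {Proc : Type u} {Value : Type v} (x₀ : Proc → Value)
    (π : SeqExec Proc (RWOp Value) (RWResp (Proc → Value))) : Prop :=
  ∀ i a, π i = some a →
    (∀ x, a.op = .write x → a.resp = .ack) ∧
    (a.op = .read → ∃ x : Proc → Value, a.resp = .val x ∧
      ∀ q, LastWritten {q} (x₀ q) π i (x q))

/-- Multi-writer multi-reader atomic registers. -/
def atomicRegister (Proc : Type u) {Value : Type v} (x₀ : Value) :
    ObjectSpec Proc (RWOp Value) (RWResp Value) where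
  usage := History.Sequential
  safety := Linearizable (RegisterCorrect x₀)

/-- Single-writer multi-reader atomic snapshots. -/
def atomicSnapshot {Proc : Type u} {Value : Type v} (x₀ : Proc → Value) :
    ObjectSpec Proc (RWOp Value) (RWResp (Proc → Value)) where
  usage := History.Sequential
  safety := Linearizable (SnapshotCorrect x₀)

/-- Safety of lattice agreement: comparability, downward validity and upward validity. The operation
`x : L` is `propose(x)`. -/
structure LatticeAgreementSafety {Proc : Type u} {L : Type v} [SemilatticeSup L]
    (h : History Proc L L) : Prop where
  comparability : ∀ t₁ s₁ y₁ t₂ s₂ y₂, h.Returns t₁ s₁ y₁ → h.Returns t₂ s₂ y₂ →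
    y₁ ≤ y₂ ∨ y₂ ≤ y₁
  downward : ∀ t p x s y, h.Invokes t p x → h.Returns t s y → x ≤ y
  upward : ∀ t s y, h.Returns t s y →
    ∃ z, IsLUB {x | ∃ t' p, h.Invokes t' p x} z ∧ y ≤ z

/-- Single-shot lattice agreement over the join-semilattice `L`. -/
def latticeAgreement (Proc : Type u) (L : Type v) [SemilatticeSup L] : ObjectSpec Proc L L where
  usage := History.SingleShot
  safety := LatticeAgreementSafety

/-! ## Implementations and obstruction-freedom -/

/-- The operation invoked in an action with this input, if any. -/
def Input.op? {Proc : Type u} {Op : Type v} {Msg : Type w} : Input Proc Op Msg → Option Op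
  | .invoke o => some o
  | _ => none

/-- The part of an event that is visible to the clients. -/
def Event.entry {Proc : Type u} {Op : Type v} {Resp : Type v'} {Msg : Type w} :
    Event Proc Op Resp Msg → Option (HistEntry Proc Op Resp)
  | .act p i r => some ⟨p, i.op?, r⟩
  | _ => none

namespace Algorithm

variable {Proc : Type u} {Op : Type v} {Resp : Type v'} {A : Algorithm.{u, v, v', w} Proc Op Resp}

namespace Execution

/-- The history of an execution. -/
def history (σ : A.Execution) : History Proc Op Resp := fun t => (σ.ev t).bind Event.entry

/-- `p` is correct in `σ`: it never crashes. -/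
def Correct (σ : A.Execution) (p : Proc) : Prop := ∀ t, σ.ev t ≠ some (.crash p)

/-- `σ` is `f`-compliant: at most the processes and the channels listed in `f` fail. -/
def Compliant (σ : A.Execution) (f : FailurePattern Proc) : Prop :=
  (∀ t p, σ.ev t = some (.crash p) → p ∈ f.procs) ∧
  (∀ t p q, σ.ev t = some (.disconnect p q) → (p, q) ∈ f.chans)

/-- Every correct process takes infinitely many (spontaneous) steps. -/
def Fair (σ : A.Execution) : Prop :=
  ∀ p, σ.Correct p → ∀ t, ∃ t' ≥ t, ∃ r, σ.ev t' = some (.act p .tick r)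

/-- Every message that a correct process sends to a correct process, through a channel that has not
disconnected yet, is eventually received. (Messages sent through a disconnected channel never
enter the network.) -/
def Reliable (σ : A.Execution) : Prop :=
  ∀ t p q m, (p, q, m) ∈ (σ.conf t).net → σ.Correct p → σ.Correct q →
    ∃ t' ≥ t, ∃ r, σ.ev t' = some (.act q (.receive p m) r)

/-- The operation invoked at `t` eventually executes solo: for some suffix of `σ`, all other
operations that are concurrent with it and still in progress in the suffix (that is, have not
returned before the suffix begins) are invoked by faulty processes. -/
def EventuallySolo (σ : A.Execution) (t : ℕ) : Prop :=
  ∃ s, ∀ t' q o, t' ≠ t → σ.history.Invokes t' q o → σ.history.Concurrent t t' →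
    (∀ s' r, σ.history.Returns t' s' r → s ≤ s') → ¬ σ.Correct q

end Execution

/-- `(f, T)`-obstruction-freedom of an algorithm whose clients respect `usage`. -/
def ObstructionFree (A : Algorithm.{u, v, v', w} Proc Op Resp)
    (usage : History Proc Op Resp → Prop) (f : FailurePattern Proc) (T : Set Proc) : Prop :=
  ∀ σ : A.Execution, usage σ.history → σ.Compliant f → σ.Fair → σ.Reliable →
    ∀ p ∈ T, ∀ t o, σ.history.Invokes t p o → σ.EventuallySolo t →
      ∃ t' r, σ.history.Returns t t' r

/-- `A` is an `(F, τ)`-obstruction-free implementation of the object `O`. -/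
structure Implements (A : Algorithm.{u, v, v', w} Proc Op Resp) (O : ObjectSpec Proc Op Resp)
    (F : Set (FailurePattern Proc)) (τ : FailurePattern Proc → Set Proc) : Prop where
  safety : ∀ σ : A.Execution, O.usage σ.history → O.safety σ.history
  liveness : ∀ f ∈ F, A.ObstructionFree O.usage f (τ f)

end Algorithm

/-! For `p ∈ τ f`, take as read quorum the set of processes that can reach `p` in the residual graph
of `f`, and as write quorum the strongly connected component of `p` there. Availability and `τ f ⊆
U_f` are then immediate; the content is Consistency.

Suppose that the ancestors of `p` under `f` miss the component of `q` under `g`. Let everything in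
`g` fail at once and let `q` run an operation `o` solo until it returns. Let `S` be the ancestors of
`q` under `g`, and `B` the set `S` without the component of `q`. Both sets are closed under
predecessors, so they receive nothing from outside, and the actions of `S` alone, or of `B` alone,
can be replayed without any failure (`Replays.run`). The replay of `B` contains no invocation. After
it, let everything in `f` fail and let `p` run `o'` solo until it returns
(`Implements.exists_solo`). The ancestors of `p` cannot tell the replay of `B` from that of `S`:
only the component of `q` acts differently. Hence their actions can also be replayed after those of
`S`. The result is a failure-free execution in which `o` returns before `o'` is invoked, although
both give the responses of solo runs (`Implements.ancestors_inter_scc`).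

For each object some pair of operations excludes this: a write of a non-initial value followed by a
read, or proposals of two incomparable elements. -/

namespace Algorithm

variable {Proc : Type u} {Op : Type v} {Resp : Type v'} {A : Algorithm.{u, v, v', w} Proc Op Resp}

/-! ## Finite runs -/

/-- What happens at one instant: nothing, or a step. -/
def Advance (A : Algorithm.{u, v, v', w} Proc Op Resp) (c : A.Config)
    (e : Option (Event Proc Op Resp A.Msg)) (c' : A.Config) : Prop :=
  (e = none ∧ c' = c) ∨ ∃ a, e = some a ∧ A.Step c a c'

/-- `l` leads from one configuration to another; `none` stands for an instant without events. -/
inductive Run (A : Algorithm.{u, v, v', w} Proc Op Resp) :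
    A.Config → List (Option (Event Proc Op Resp A.Msg)) → A.Config → Prop
  | nil (c : A.Config) : Run A c [] c
  | cons {c c' c'' : A.Config} {e : Option (Event Proc Op Resp A.Msg)}
      {l : List (Option (Event Proc Op Resp A.Msg))} :
      A.Advance c e c' → Run A c' l c'' → Run A c (e :: l) c''

theorem Run.append {c c' c'' : A.Config} {l l' : List (Option (Event Proc Op Resp A.Msg))}
    (h : A.Run c l c') (h' : A.Run c' l' c'') : A.Run c (l ++ l') c'' := by
  induction h with
  | nil => exact h'
  | cons a _ ih => exact .cons a (ih h')

theorem Run.single {c c' : A.Config} {e : Option (Event Proc Op Resp A.Msg)}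
    (h : A.Advance c e c') : A.Run c [e] c' :=
  .cons h (.nil _)

/-- `conf` and `ev` form an infinite run from `c`. -/
def IsRun (A : Algorithm.{u, v, v', w} Proc Op Resp) (c : A.Config) (conf : ℕ → A.Config)
    (ev : ℕ → Option (Event Proc Op Resp A.Msg)) : Prop :=
  conf 0 = c ∧ ∀ t, A.Advance (conf t) (ev t) (conf (t + 1))

/-- The sequence that begins with `l` and goes on as `s`. -/
def prepend {α : Type*} (l : List α) (s : ℕ → α) (t : ℕ) : α :=
  l[t]?.getD (s (t - l.length))

theorem prepend_add {α : Type*} (l : List α) (s : ℕ → α) (t : ℕ) :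
    prepend l s (l.length + t) = s t := by
  simp [prepend]

theorem prepend_mem {α : Type*} {l : List α} {s : ℕ → α} {t : ℕ} (h : t < l.length) :
    prepend l s t ∈ l := by
  simp [prepend, h]

theorem prepend_append_left {α : Type*} {l : List α} {s s' : ℕ → α} (l' : List α) {t : ℕ}
    (h : t < l.length) : prepend (l ++ l') s t = prepend l s' t := by
  simp [prepend, h, List.getElem?_append_left h]

theorem prepend_append_right {α : Type*} (l l' : List α) (s : ℕ → α) (t : ℕ) :
    prepend (l ++ l') s (l.length + t) = prepend l' s t := by
  simp only [prepend, List.length_append]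
  rw [List.getElem?_append_right (by omega)]
  rw [Nat.add_sub_cancel_left, Nat.add_sub_add_left]

theorem Run.prepend {c c' : A.Config} {l : List (Option (Event Proc Op Resp A.Msg))}
    (h : A.Run c l c') {conf : ℕ → A.Config} {ev : ℕ → Option (Event Proc Op Resp A.Msg)}
    (h' : A.IsRun c' conf ev) :
    ∃ conf', A.IsRun c conf' (prepend l ev) ∧ ∀ t, conf' (l.length + t) = conf t := by
  induction h with
  | nil c => exact ⟨conf, by simpa [IsRun, Algorithm.prepend] using h', by simp⟩
  | @cons c _ _ e l a _ ih =>
    obtain ⟨conf', ⟨h0, h1⟩, h2⟩ := ih h'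
    refine ⟨fun t => t.casesOn c conf', ⟨rfl, ?_⟩, fun t => ?_⟩
    · rintro (_ | t)
      · simpa [Algorithm.prepend, h0] using a
      · simpa [Algorithm.prepend] using h1 t
    · rw [List.length_cons, show l.length + 1 + t = (l.length + t) + 1 by omega]
      exact h2 t

theorem IsRun.run {c : A.Config} {conf : ℕ → A.Config}
    {ev : ℕ → Option (Event Proc Op Resp A.Msg)} (h : A.IsRun c conf ev) (T : ℕ) :
    A.Run c ((List.range T).map ev) (conf T) := by
  induction T with
  | zero => simpa [h.1] using Run.nil _
  | succ T ih => simpa [List.range_succ] using ih.append (.single (h.2 T))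

theorem isRun_const (c : A.Config) : A.IsRun c (fun _ => c) fun _ => none :=
  ⟨rfl, fun _ => .inl ⟨rfl, rfl⟩⟩

/-- The execution formed by an infinite run from the initial configuration. -/
def IsRun.execution {conf : ℕ → A.Config} {ev : ℕ → Option (Event Proc Op Resp A.Msg)}
    (h : A.IsRun A.initial conf ev) : A.Execution :=
  ⟨conf, ev, h.1, h.2⟩

/-! ## Replaying the actions of a set of processes without failures -/

open Classical in
/-- The configuration after an action of `p` triggered by `i`, with new state `s` and output
`out`. -/
noncomputable def Config.fire (c : A.Config) (p : Proc) (i : Input Proc Op A.Msg) (s : A.State)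
    (out : List (Proc × A.Msg)) : A.Config :=
  { c with
    state := Function.update c.state p s
    net := (match i with
      | .receive q m => c.net.erase (q, p, m)
      | _ => c.net) + A.sent c.down p out }

theorem Config.step_fire (c : A.Config) {p : Proc} {i : Input Proc Op A.Msg} {s : A.State}
    {out : List (Proc × A.Msg)} {r : Option Resp} (alive : p ∉ c.crashed)
    (input : ∀ q m, i = .receive q m → (q, p, m) ∈ c.net)
    (tr : (s, out, r) ∈ A.trans p (c.state p) i) :
    A.Step c (.act p i r) (c.fire p i s out) := by
  classical
  refine .act c p i _ s out r alive ?_ tr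
  cases i with
  | receive q m => exact (Multiset.cons_erase (input q m rfl)).symm
  | _ => rfl

/-- The multiset left after consuming the input is unique, so `erase` computes it. Action steps thus
become a function of the new state and the output, and networks can be compared by counting copies.
-/
theorem Step.eq_fire {c c' : A.Config} {p : Proc} {i : Input Proc Op A.Msg} {r : Option Resp}
    (h : A.Step c (.act p i r) c') :
    p ∉ c.crashed ∧ (∀ q m, i = .receive q m → (q, p, m) ∈ c.net) ∧
      ∃ s out, (s, out, r) ∈ A.trans p (c.state p) i ∧ c' = c.fire p i s out := by
  classical
  cases h with
  | act _ _ N s out _ alive input tr =>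
    refine ⟨alive, ?_, s, out, tr, ?_⟩
    · rintro q m rfl
      have : c.net = _ := input
      simp [this]
    · cases i with
      | receive q m =>
        have : c.net = _ := input
        simp [Config.fire, this]
      | _ =>
        have : c.net = _ := input
        simp [Config.fire, this]

open Classical in
-- A failure-free replay drops nothing, so it holds at least the messages of the original run.
theorem count_sent_le (down : Set (Proc × Proc)) (p : Proc) (out : List (Proc × A.Msg))
    (x : Proc × Proc × A.Msg) :
    (A.sent down p out).count x ≤ (A.sent ∅ p out).count x := by
  apply Multiset.count_le_of_le
  simp only [sent, Multiset.coe_le]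
  refine (List.Sublist.map _ ?_).subperm
  simp

theorem mem_sent {down : Set (Proc × Proc)} {p : Proc} {out : List (Proc × A.Msg)}
    {x : Proc × Proc × A.Msg} (h : x ∈ A.sent down p out) : x.1 = p ∧ (p, x.2.1) ∉ down := by
  simp only [sent, Multiset.mem_coe, List.mem_map, List.mem_filter, decide_eq_true_eq] at h
  obtain ⟨a, ⟨-, h⟩, rfl⟩ := h
  exact ⟨rfl, h⟩

open Classical in
/-- The effect of an action of `p` on the number of copies of a message in transit. -/
theorem Config.count_fire (c : A.Config) (p : Proc) (i : Input Proc Op A.Msg) (s : A.State)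
    (out : List (Proc × A.Msg)) (x : Proc × Proc × A.Msg) :
    (c.fire p i s out).net.count x =
      c.net.count x - (if i = .receive x.1 x.2.2 ∧ x.2.1 = p then 1 else 0) +
        (A.sent c.down p out).count x := by
  obtain ⟨a, b, m⟩ := x
  cases i with
  | receive q m' =>
    simp only [fire, Multiset.count_add]
    by_cases h : (a, b, m) = (q, p, m')
    · simp only [Prod.mk.injEq] at h
      obtain ⟨rfl, rfl, rfl⟩ := h
      simp
    · rw [Multiset.count_erase_of_ne h, if_neg, Nat.sub_zero]
      simp only [Input.receive.injEq]
      rintro ⟨⟨rfl, rfl⟩, rfl⟩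
      exact h rfl
  | _ => simp [fire]

open Classical in
/-- Erase all events but the actions of the processes in `S`. -/
noncomputable def restrict {Msg : Type w} (S : Set Proc) :
    Option (Event Proc Op Resp Msg) → Option (Event Proc Op Resp Msg)
  | some (.act p i r) => if p ∈ S then some (.act p i r) else none
  | _ => none

/-- No message sent from outside of `S` to a process in `S` enters the network. -/
def Isolated (c : A.Config) (S : Set Proc) : Prop :=
  ∀ p ∉ S, ∀ q ∈ S, p ∈ c.crashed ∨ (p, q) ∈ c.down

open Classical in
/-- The failure-free configurations `m` and `e` result from `c` by replaying only the actions of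
`S`, and only those of `B`, respectively. -/
structure Replays (S B : Set Proc) (c m e : A.Config) : Prop where
  crashed_left : m.crashed = ∅
  down_left : m.down = ∅
  crashed_right : e.crashed = ∅
  down_right : e.down = ∅
  state_left : ∀ p ∈ S, m.state p = c.state p
  state_right : ∀ p ∉ S \ B, e.state p = m.state p
  net_left : ∀ x, x.2.1 ∈ S → c.net.count x ≤ m.net.count x
  net_right : ∀ x, x.2.1 ∈ B → c.net.count x ≤ e.net.count x
  net_le : ∀ x, x.2.1 ∉ S \ B → e.net.count x ≤ m.net.count x
  isolated_left : Isolated c S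
  isolated_right : Isolated c B

open Classical in
-- A live process outside `S` can address `S` only through disconnected channels, so all that it
-- sends there is dropped.
theorem Isolated.count_fire_le {S : Set Proc} {c : A.Config} (h : Isolated c S) {p : Proc}
    (hp : p ∉ S) (alive : p ∉ c.crashed) (i : Input Proc Op A.Msg) (s : A.State)
    (out : List (Proc × A.Msg)) {x : Proc × Proc × A.Msg} (hx : x.2.1 ∈ S) :
    (c.fire p i s out).net.count x ≤ c.net.count x := by
  have : (A.sent c.down p out).count x = 0 := by
    refine Multiset.count_eq_zero.2 fun hm => ?_
    exact (mem_sent hm).2 ((h p hp _ hx).resolve_left alive)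
  rw [Config.count_fire, this]
  omega

/-- Failures only strengthen isolation. An action in `B` is repeated in both replays, one in `S \ B`
only in the left replay, and one outside `S` in neither. The two replays are compared only away from
`S \ B`, in local states and in messages addressed there, because those processes move and receive
on one side only. -/
theorem Replays.advance {S B : Set Proc} (hB : B ⊆ S) {c c' m e : A.Config}
    {a : Option (Event Proc Op Resp A.Msg)} (h : Replays S B c m e) (ha : A.Advance c a c') :
    ∃ m' e', A.Advance m (restrict S a) m' ∧ A.Advance e (restrict B a) e' ∧
      Replays S B c' m' e' := by
  classical
  rcases ha with ⟨rfl, rfl⟩ | ⟨a, rfl, ha⟩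
  · exact ⟨m, e, .inl ⟨rfl, rfl⟩, .inl ⟨rfl, rfl⟩, h⟩
  cases a with
  | crash p =>
    refine ⟨m, e, .inl ⟨rfl, rfl⟩, .inl ⟨rfl, rfl⟩, ?_⟩
    cases ha
    exact { h with
      isolated_left := fun p hp q hq => (h.isolated_left p hp q hq).imp_left (Set.mem_insert_of_mem _)
      isolated_right := fun p hp q hq =>
        (h.isolated_right p hp q hq).imp_left (Set.mem_insert_of_mem _) }
  | disconnect p q =>
    refine ⟨m, e, .inl ⟨rfl, rfl⟩, .inl ⟨rfl, rfl⟩, ?_⟩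
    cases ha
    exact { h with
      isolated_left := fun p hp q hq =>
        (h.isolated_left p hp q hq).imp_right (Set.mem_insert_of_mem _)
      isolated_right := fun p hp q hq =>
        (h.isolated_right p hp q hq).imp_right (Set.mem_insert_of_mem _) }
  | act p i r =>
    obtain ⟨alive, input, s, out, tr, rfl⟩ := ha.eq_fire
    have sent_le := fun x => A.count_sent_le c.down p out x
    by_cases hpS : p ∈ S
    · have hm : A.Step m (.act p i r) (m.fire p i s out) := by
        refine m.step_fire (by simp [h.crashed_left]) (fun q m' hi => ?_) ?_
        · have := Multiset.count_pos.2 (input q m' hi)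
          exact Multiset.count_pos.1 (this.trans_le (h.net_left _ hpS))
        · rwa [h.state_left p hpS]
      by_cases hpB : p ∈ B
      · have he : A.Step e (.act p i r) (e.fire p i s out) := by
          refine e.step_fire (by simp [h.crashed_right]) (fun q m' hi => ?_) ?_
          · have := Multiset.count_pos.2 (input q m' hi)
            exact Multiset.count_pos.1 (this.trans_le (h.net_right _ hpB))
          · rwa [h.state_right p (fun hp => hp.2 hpB), h.state_left p hpS]
        refine ⟨_, _, .inr ⟨_, by simp [restrict, hpS], hm⟩, .inr ⟨_, by simp [restrict, hpB], he⟩,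
          h.crashed_left, h.down_left, h.crashed_right, h.down_right, ?_, ?_, ?_, ?_, ?_,
          h.isolated_left, h.isolated_right⟩
        · intro q hq
          simp only [Config.fire, Function.update_apply]
          split_ifs
          · rfl
          · exact h.state_left q hq
        · intro q hq
          simp only [Config.fire, Function.update_apply]
          split_ifs
          · rfl
          · exact h.state_right q hq
        -- Both networks lose the same consumed copy, and the failure-free one gains at least as
        -- many new copies.
        · intro x hx
          have := h.net_left x hx
          have := sent_le x
          rw [Config.count_fire, Config.count_fire, h.down_left]
          omega
        · intro x hx
          have := h.net_right x hx
          have := sent_le x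
          rw [Config.count_fire, Config.count_fire, h.down_right]
          omega
        · intro x hx
          have := h.net_le x hx
          rw [Config.count_fire, Config.count_fire, h.down_right, h.down_left]
          omega
      · refine ⟨_, _, .inr ⟨_, by simp [restrict, hpS], hm⟩, .inl ⟨by simp [restrict, hpB], rfl⟩,
          h.crashed_left, h.down_left, h.crashed_right, h.down_right, ?_, ?_, ?_, ?_, ?_,
          h.isolated_left, h.isolated_right⟩
        · intro q hq
          simp only [Config.fire, Function.update_apply]
          split_ifs
          · rfl
          · exact h.state_left q hq
        · intro q hq
          have : q ≠ p := fun hqp => hq (hqp ▸ ⟨hpS, hpB⟩)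
          simpa [Config.fire, this] using h.state_right q hq
        · intro x hx
          have := h.net_left x hx
          have := sent_le x
          rw [Config.count_fire, Config.count_fire, h.down_left]
          omega
        · intro x hx
          exact (h.isolated_right.count_fire_le hpB alive i s out hx).trans (h.net_right x hx)
        · intro x hx
          have := h.net_le x hx
          -- The consumed message is addressed to `p ∈ S \ B`, hence is not `x`; the left network
          -- can only gain copies of `x`.
          rw [Config.count_fire, if_neg]
          · omega
          · rintro ⟨-, rfl⟩
            exact hx ⟨hpS, hpB⟩
    · have hpB : p ∉ B := fun hp => hpS (hB hp)
      refine ⟨m, e, .inl ⟨by simp [restrict, hpS], rfl⟩, .inl ⟨by simp [restrict, hpB], rfl⟩,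
        h.crashed_left, h.down_left, h.crashed_right, h.down_right, ?_, h.state_right, ?_, ?_,
        h.net_le, h.isolated_left, h.isolated_right⟩
      · intro q hq
        have : q ≠ p := fun hqp => hpS (hqp ▸ hq)
        simpa [Config.fire, this] using h.state_left q hq
      · intro x hx
        exact (h.isolated_left.count_fire_le hpS alive i s out hx).trans (h.net_left x hx)
      · intro x hx
        exact (h.isolated_right.count_fire_le hpB alive i s out hx).trans (h.net_right x hx)

theorem Replays.run {S B : Set Proc} (hB : B ⊆ S) {c c' : A.Config}
    {l : List (Option (Event Proc Op Resp A.Msg))} (hl : A.Run c l c') :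
    ∀ {m e : A.Config}, Replays S B c m e → ∃ m' e', A.Run m (l.map (restrict S)) m' ∧
      A.Run e (l.map (restrict B)) e' ∧ Replays S B c' m' e' := by
  induction hl with
  | nil c => exact fun h => ⟨_, _, .nil _, .nil _, h⟩
  | cons a _ ih =>
    intro m e h
    obtain ⟨m₁, e₁, hm₁, he₁, h₁⟩ := h.advance hB a
    obtain ⟨m₂, e₂, hm₂, he₂, h₂⟩ := ih h₁
    exact ⟨m₂, e₂, .cons hm₁ hm₂, .cons he₁ he₂, h₂⟩

end Algorithm

namespace Algorithm

variable {Proc : Type u} {Op : Type v} {Resp : Type v'} {A : Algorithm.{u, v, v', w} Proc Op Resp}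

/-! ## Fair continuations -/

/-- A fair scheduler: if every task can be attempted in every state, then there is a sequence of
attempts in which every task that comes up is attempted later. -/
theorem exists_fair_schedule {X K : Type*} (tasks : X → List K) (R : X → Option K → X → Prop)
    (hR : ∀ x k, ∃ x', R x k x') (x₀ : X) :
    ∃ (c : ℕ → X) (κ : ℕ → Option K), c 0 = x₀ ∧ (∀ n, R (c n) (κ n) (c (n + 1))) ∧
      ∀ t, ∀ k ∈ tasks (c t), ∃ n ≥ t, κ n = some k := by
  choose step hstep using hR
  -- Attempt number `Nat.pair t j` is devoted to the `j`-th task present at time `t`, which is never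
  -- later than the attempt.
  let κ (c : ℕ → X) (n : ℕ) : Option K := (tasks (c n.unpair.1))[n.unpair.2]?
  -- Since attempt `n` may consult any earlier state, the recursion carries the whole sequence; `H
  -- n` is final at the indices up to `n`.
  let H (n : ℕ) : ℕ → X :=
    n.rec (fun _ => x₀) fun n c => Function.update c (n + 1) (step (c n) (κ c n))
  have hH : ∀ i d, H (i + d) i = H i i := by
    intro i d
    induction d with
    | zero => rfl
    | succ d ih =>
      rw [← ih]
      exact Function.update_of_ne (Nat.lt_succ_of_le (Nat.le_add_right i d)).ne _ _
  have hκ : ∀ n, κ (fun i => H i i) n = κ (H n) n := by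
    intro n
    obtain ⟨d, hd⟩ := Nat.exists_eq_add_of_le (Nat.unpair_left_le n)
    have := hH n.unpair.1 d
    rw [← hd] at this
    simp only [κ, this]
  refine ⟨fun i => H i i, κ fun i => H i i, rfl, fun n => ?_, fun t k hk => ?_⟩
  · have : H (n + 1) (n + 1) = step (H n n) (κ (H n) n) := Function.update_self ..
    beta_reduce
    rw [this, hκ]
    exact hstep _ _
  · obtain ⟨j, hj⟩ := List.mem_iff_getElem?.1 hk
    exact ⟨Nat.pair t j, Nat.left_le_pair t j, by simpa [κ] using hj⟩

/-- What a scheduler can do: let a process tick, or deliver a message. -/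
inductive Task (A : Algorithm.{u, v, v', w} Proc Op Resp) where
  | tick (p : Proc)
  | deliver (x : Proc × Proc × A.Msg)

/-- From every configuration there is an infinite run without invocations and failures in which the
processes that have not crashed take infinitely many steps and receive all their messages. -/
theorem exists_fair_run [Finite Proc] (c : A.Config) :
    ∃ conf ev, A.IsRun c conf ev ∧
      (∀ t, ev t = none ∨ ∃ p i r, ev t = some (.act p i r) ∧ i.op? = none) ∧
      (∀ p ∉ c.crashed, ∀ t, ∃ t' ≥ t, ∃ r, ev t' = some (.act p .tick r)) ∧
      ∀ t p q m, (p, q, m) ∈ (conf t).net → q ∉ c.crashed →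
        ∃ t' ≥ t, (p, q, m) ∈ (conf t').net → ∃ r, ev t' = some (.act q (.receive p m) r) := by
  classical
  have := Fintype.ofFinite Proc
  let tasks (d : A.Config) : List (Task A) :=
    (Finset.univ : Finset Proc).toList.map .tick ++ d.net.toList.map .deliver
  let R (d : A.Config) (k : Option (Task A)) (d' : A.Config) : Prop :=
    ∃ e, A.Advance d e d' ∧ d'.crashed = d.crashed ∧
      (e = none ∨ ∃ p i r, e = some (.act p i r) ∧ i.op? = none) ∧
      (∀ p, k = some (.tick p) → p ∉ d.crashed → ∃ r, e = some (.act p .tick r)) ∧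
      ∀ p q m, k = some (.deliver (p, q, m)) → q ∉ d.crashed → (p, q, m) ∈ d.net →
        ∃ r, e = some (.act q (.receive p m) r)
  have fire (d : A.Config) (p : Proc) (i : Input Proc Op A.Msg) (hp : p ∉ d.crashed)
      (hi : ∀ q m, i = .receive q m → (q, p, m) ∈ d.net) :
      ∃ r d', A.Step d (.act p i r) d' ∧ d'.crashed = d.crashed := by
    obtain ⟨⟨s, out, r⟩, tr⟩ := A.total p (d.state p) i
    exact ⟨r, _, d.step_fire hp hi tr, rfl⟩
  have hR : ∀ d k, ∃ d', R d k d' := by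
    intro d k
    -- A task that is not enabled is attempted by letting an instant pass.
    have idle (h₁ : ∀ p, k = some (.tick p) → p ∈ d.crashed)
        (h₂ : ∀ p q m, k = some (.deliver (p, q, m)) → q ∉ d.crashed → (p, q, m) ∉ d.net) :
        ∃ d', R d k d' :=
      ⟨d, none, .inl ⟨rfl, rfl⟩, rfl, .inl rfl, fun p hk hp => absurd (h₁ p hk) hp,
        fun p q m hk hq hm => absurd hm (h₂ p q m hk hq)⟩
    match k with
    | none => exact idle (by simp) (by simp)
    | some (.tick p) =>
      by_cases hp : p ∈ d.crashed
      · exact idle (by rintro _ ⟨⟩; exact hp) (by simp)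
      · obtain ⟨r, d', hd, hd'⟩ := fire d p .tick hp (by simp)
        refine ⟨d', _, .inr ⟨_, rfl, hd⟩, hd', .inr ⟨_, _, _, rfl, rfl⟩, ?_, by simp⟩
        rintro _ ⟨⟩ -
        exact ⟨r, rfl⟩
    | some (.deliver (p, q, m)) =>
      by_cases hq : q ∉ d.crashed ∧ (p, q, m) ∈ d.net
      · obtain ⟨r, d', hd, hd'⟩ := fire d q (.receive p m) hq.1 (by rintro _ _ ⟨⟩; exact hq.2)
        refine ⟨d', _, .inr ⟨_, rfl, hd⟩, hd', .inr ⟨_, _, _, rfl, rfl⟩, by simp, ?_⟩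
        rintro _ _ _ ⟨⟩ - -
        exact ⟨r, rfl⟩
      · refine idle (by simp) ?_
        rintro _ _ _ ⟨⟩ h₁ h₂
        exact hq ⟨h₁, h₂⟩
  obtain ⟨conf, κ, h0, hstep, hfair⟩ := exists_fair_schedule tasks R hR c
  choose ev hadv hcr hact htick hdel using hstep
  have hcr' : ∀ t, (conf t).crashed = c.crashed := by
    intro t
    induction t with
    | zero => rw [h0]
    | succ t ih => rw [hcr, ih]
  refine ⟨conf, ev, ⟨h0, hadv⟩, hact, fun p hp t => ?_, fun t p q m hm hq => ?_⟩
  · obtain ⟨n, hn, hk⟩ := hfair t (.tick p) (by simp [tasks])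
    exact ⟨n, hn, htick n p hk (by rwa [hcr'])⟩
  · obtain ⟨n, hn, hk⟩ := hfair t (.deliver (p, q, m)) (by simp [tasks, hm])
    exact ⟨n, hn, hdel n p q m hk (by rwa [hcr'])⟩

/-! ## Crashes and messages in executions -/

theorem Execution.exists_crash (σ : A.Execution) {p : Proc} {t : ℕ}
    (h : p ∈ (σ.conf t).crashed) : ∃ t', σ.ev t' = some (.crash p) := by
  induction t with
  | zero => simp [σ.conf_zero, initial] at h
  | succ t ih =>
    rcases σ.next t with ⟨-, h'⟩ | ⟨a, ha, h'⟩
    · exact ih (h' ▸ h)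
    · cases a with
      | act =>
        obtain ⟨_, _, _, _, _, h'⟩ := h'.eq_fire
        exact ih (by rw [h'] at h; exact h)
      | crash q =>
        generalize σ.conf (t + 1) = d at h h'
        cases h'
        rcases h with rfl | h
        · exact ⟨t, ha⟩
        · exact ih h
      | disconnect =>
        generalize σ.conf (t + 1) = d at h h'
        cases h'
        exact ih h

/-- Only its receipt removes a message in transit; crashes and disconnections leave the network as
it is. -/
theorem Execution.mem_net_of_le (σ : A.Execution) {p q : Proc} {m : A.Msg} {t t' : ℕ}
    (hm : (p, q, m) ∈ (σ.conf t).net)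
    (h : ∀ s ≥ t, ∀ r, σ.ev s ≠ some (.act q (.receive p m) r)) (ht : t ≤ t') :
    (p, q, m) ∈ (σ.conf t').net := by
  classical
  induction t', ht using Nat.le_induction with
  | base => exact hm
  | succ t' ht ih =>
    rcases σ.next t' with ⟨-, h'⟩ | ⟨a, ha, h'⟩
    · rwa [h']
    · cases a with
      | act q' i r =>
        obtain ⟨_, _, _, _, _, h'⟩ := h'.eq_fire
        rw [h', ← Multiset.count_pos, Config.count_fire, if_neg]
        · have := Multiset.count_pos.2 ih
          omega
        · rintro ⟨rfl, rfl⟩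
          exact h t' ht r ha
      | crash =>
        generalize σ.conf (t' + 1) = d at h' ⊢
        cases h'
        exact ih
      | disconnect =>
        generalize σ.conf (t' + 1) = d at h' ⊢
        cases h'
        exact ih

/-! ## Failing everything that may fail -/

/-- With finitely many processes and channels, finitely many failure events suffice, and they change
neither states nor messages in transit. -/
theorem exists_run_fail [Finite Proc] (c : A.Config) (f : FailurePattern Proc) :
    ∃ l c', A.Run c l c' ∧ c'.state = c.state ∧ c'.net = c.net ∧
      c'.crashed = c.crashed ∪ f.procs ∧ c'.down = c.down ∪ f.chans ∧
      ∀ e ∈ l, (∃ p ∈ f.procs, e = some (.crash p)) ∨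
        ∃ p q, (p, q) ∈ f.chans ∧ e = some (.disconnect p q) := by
  have crash (P : Set Proc) (hP : P.Finite) : ∃ l, A.Run c l { c with crashed := c.crashed ∪ P } ∧
      ∀ e ∈ l, ∃ p ∈ P, e = some (.crash p) := by
    induction P, hP using Set.Finite.induction_on with
    | empty => exact ⟨[], by simpa using Run.nil c, by simp⟩
    | @insert p P _ _ ih =>
      obtain ⟨l, hl, hl'⟩ := ih
      refine ⟨l ++ [some (.crash p)], hl.append (.single (.inr ⟨_, rfl, ?_⟩)), ?_⟩
      · rw [Set.union_insert]
        exact Step.crash _ p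
      · intro e he
        rcases List.mem_append.1 he with he | he
        · obtain ⟨q, hq, rfl⟩ := hl' e he
          exact ⟨q, .inr hq, rfl⟩
        · exact ⟨p, .inl rfl, List.mem_singleton.1 he⟩
  have disconnect (c : A.Config) (C : Set (Proc × Proc)) (hC : C.Finite) :
      ∃ l, A.Run c l { c with down := c.down ∪ C } ∧
        ∀ e ∈ l, ∃ p q, (p, q) ∈ C ∧ e = some (.disconnect p q) := by
    induction C, hC using Set.Finite.induction_on with
    | empty => exact ⟨[], by simpa using Run.nil c, by simp⟩
    | @insert x C _ _ ih =>
      obtain ⟨l, hl, hl'⟩ := ih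
      refine ⟨l ++ [some (.disconnect x.1 x.2)], hl.append (.single (.inr ⟨_, rfl, ?_⟩)), ?_⟩
      · rw [Set.union_insert]
        exact Step.disconnect _ x.1 x.2
      · intro e he
        rcases List.mem_append.1 he with he | he
        · obtain ⟨p, q, hq, rfl⟩ := hl' e he
          exact ⟨p, q, .inr hq, rfl⟩
        · exact ⟨x.1, x.2, .inl rfl, List.mem_singleton.1 he⟩
  obtain ⟨l, hl, hl'⟩ := crash f.procs f.procs.toFinite
  obtain ⟨l₂, hl₂, hl₂'⟩ := disconnect _ f.chans f.chans.toFinite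
  refine ⟨l ++ l₂, _, hl.append hl₂, rfl, rfl, rfl, rfl, fun e he => ?_⟩
  exact (List.mem_append.1 he).imp (hl' e) (hl₂' e)

end Algorithm

/-! ## Solo operations -/

namespace History

variable {Proc : Type u} {Op : Type v} {Resp : Type v'}

/-- The only invocation in `h` is that of `o` by `p` at instant `t`. -/
def Solo (h : History Proc Op Resp) (t : ℕ) (p : Proc) (o : Op) : Prop :=
  ∀ t' p' o', h.Invokes t' p' o' ↔ t' = t ∧ p' = p ∧ o' = o

theorem Solo.invokes {h : History Proc Op Resp} {t : ℕ} {p : Proc} {o : Op} (hs : h.Solo t p o) :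
    h.Invokes t p o :=
  (hs t p o).2 ⟨rfl, rfl, rfl⟩

theorem Solo.singleShot {h : History Proc Op Resp} {t : ℕ} {p : Proc} {o : Op}
    (hs : h.Solo t p o) : h.SingleShot :=
  fun _ _ _ _ _ h₁ h₂ => ((hs _ _ _).1 h₁).1.trans ((hs _ _ _).1 h₂).1.symm

/-- Shifting the origin of time. -/
theorem Returns.shift {h h' : History Proc Op Resp} {n t t' : ℕ} {y : Resp}
    (hh : ∀ s, t ≤ s → s ≤ t' → h' (n + s) = h s) (hr : h.Returns t t' y) :
    h'.Returns (n + t) (n + t') y := by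
  obtain ⟨p, o, ⟨e, he, hi⟩, ht, ⟨e', he', hi'⟩, hn⟩ := hr
  refine ⟨p, o, ⟨e, (hh t le_rfl ht).trans he, hi⟩, by omega,
    ⟨e', (hh t' ht le_rfl).trans he', hi'⟩, ?_⟩
  rintro s h₁ h₂ r' ⟨e'', he'', hi''⟩
  obtain ⟨d, rfl⟩ := Nat.exists_eq_add_of_le (show n ≤ s by omega)
  exact hn d (by omega) (by omega) r' ⟨e'', (hh d (by omega) (by omega)).symm.trans he'', hi''⟩

end History

/-! ### Histories of event sequences and solo runs -/

namespace Algorithm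

variable {Proc : Type u} {Op : Type v} {Resp : Type v'} {A : Algorithm.{u, v, v', w} Proc Op Resp}

/-- The history of a sequence of events. -/
def hist {Msg : Type w} (ev : ℕ → Option (Event Proc Op Resp Msg)) : History Proc Op Resp :=
  fun t => (ev t).bind Event.entry

theorem hist_congr {Msg : Type w} {ev ev' : ℕ → Option (Event Proc Op Resp Msg)} {t t' : ℕ}
    (h : ev t = ev' t') : hist ev t = hist ev' t' := by
  rw [hist, h, hist]

theorem not_invokes_hist {Msg : Type w} {ev : ℕ → Option (Event Proc Op Resp Msg)} {t : ℕ}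
    (h : ∀ p o r, ev t ≠ some (.act p (.invoke o) r)) (p : Proc) (o : Op) :
    ¬ (hist ev).Invokes t p o := by
  rintro ⟨e, he, rfl, ho⟩
  obtain ⟨a, ha, hae⟩ := Option.bind_eq_some_iff.1 he
  cases a with
  | act p i r =>
    cases hae
    cases i with
    | invoke o' => exact h _ _ _ ha
    | _ => cases ho
  | _ => cases hae

theorem invokes_hist {Msg : Type w} {ev : ℕ → Option (Event Proc Op Resp Msg)} {t : ℕ}
    {p : Proc} {o : Op} {r : Option Resp} (h : ev t = some (.act p (.invoke o) r)) (p' : Proc)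
    (o' : Op) : (hist ev).Invokes t p' o' ↔ p' = p ∧ o' = o := by
  have : hist ev t = some ⟨p, some o, r⟩ := by rw [hist, h]; rfl
  constructor
  · rintro ⟨e, he, rfl, ho⟩
    rw [this] at he
    cases he
    cases ho
    exact ⟨rfl, rfl⟩
  · rintro ⟨rfl, rfl⟩
    exact ⟨_, this, rfl, rfl⟩

theorem invokes_congr {h h' : History Proc Op Resp} {t t' : ℕ} (e : h t = h' t') (p : Proc)
    (o : Op) : h.Invokes t p o ↔ h'.Invokes t' p o := by
  rw [History.Invokes, e, History.Invokes]

/-- The finite history of a list of events. -/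
abbrev listHist {Msg : Type w} (l : List (Option (Event Proc Op Resp Msg))) :
    History Proc Op Resp :=
  hist (prepend l fun _ => none)

/-- An obstruction-free implementation can be run so that, after a run `l₀` without invocations and
failures, everything listed in `f` fails and then an operation `o` of `p ∈ τ f` runs solo until it
returns. -/
theorem Implements.exists_solo [Finite Proc] {O : ObjectSpec Proc Op Resp}
    {F : Set (FailurePattern Proc)} {τ : FailurePattern Proc → Set Proc} (hA : A.Implements O F τ)
    (hO : ∀ h : History Proc Op Resp, h.SingleShot → O.usage h) {f : FailurePattern Proc}
    (hf : f ∈ F) {p : Proc} (hp : p ∈ τ f) (hpf : p ∉ f.procs) (o : Op)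
    {l₀ : List (Option (Event Proc Op Resp A.Msg))} {c₀ : A.Config} (run₀ : A.Run A.initial l₀ c₀)
    (crashed₀ : c₀.crashed = ∅)
    (hl₀ : ∀ e ∈ l₀, e = none ∨ ∃ p i r, e = some (.act p i r) ∧ i.op? = none) :
    ∃ cf l c' y t, cf.state = c₀.state ∧ cf.net = c₀.net ∧ f.procs ⊆ cf.crashed ∧
      f.chans ⊆ cf.down ∧ A.Run cf l c' ∧ l.length = t + 1 ∧ (listHist l).Solo 0 p o ∧
      (listHist l).Returns 0 t y ∧
      ∃ h a s, O.safety h ∧ h.Solo a p o ∧ h.Returns a s y := by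
  classical
  -- The execution consists of `l₀`, the failures `lf`, the invocation, and a fair continuation
  -- without further invocations.
  obtain ⟨lf, cf, runf, state_f, net_f, crashed_f, down_f, hlf⟩ := A.exists_run_fail c₀ f
  rw [crashed₀, Set.empty_union] at crashed_f
  obtain ⟨⟨s₁, out₁, r₁⟩, tr₁⟩ := A.total p (cf.state p) (.invoke o)
  have step₁ := cf.step_fire (r := r₁) (by rwa [crashed_f]) (by simp) tr₁
  obtain ⟨conf₂, ev₂, run₂, hev₂, htick₂, hrel₂⟩ := exists_fair_run (cf.fire p (.invoke o) s₁ out₁)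
  obtain ⟨conf₁, run₁, hconf₁⟩ := (Run.single (.inr ⟨_, rfl, step₁⟩)).prepend run₂
  obtain ⟨conf, run, hconf⟩ := (run₀.append runf).prepend run₁
  set ev₁ := prepend [some (Event.act p (.invoke o) r₁)] ev₂ with hev₁
  set l₁ := l₀ ++ lf
  set ev := prepend l₁ ev₁ with hev
  have ev_add : ∀ t, ev (l₁.length + t) = ev₁ t := prepend_add l₁ ev₁
  have ev₁_zero : ev₁ 0 = some (.act p (.invoke o) r₁) := rfl
  have ev₁_succ : ∀ t, ev₁ (t + 1) = ev₂ t := fun t => by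
    simpa [add_comm] using prepend_add [some (Event.act p (.invoke o) r₁)] ev₂ t
  have conf_add : ∀ t, conf (l₁.length + (t + 1)) = conf₂ t := fun t => by
    rw [hconf, ← hconf₁]; simp [add_comm]
  have cases₂ : ∀ t, (∃ t', t = l₁.length + (t' + 1) ∧ ev t = ev₂ t') ∨
      (t = l₁.length ∧ ev t = some (.act p (.invoke o) r₁)) ∨ (t < l₁.length ∧ ev t ∈ l₁) := by
    intro t
    rcases lt_or_ge t l₁.length with ht | ht
    · exact .inr (.inr ⟨ht, prepend_mem ht⟩)
    · obtain ⟨_ | d, rfl⟩ := Nat.exists_eq_add_of_le ht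
      · exact .inr (.inl ⟨rfl, ev_add 0⟩)
      · exact .inl ⟨d, rfl, by rw [ev_add, ev₁_succ]⟩
  have no_op₂ : ∀ t p' o' r', ev₂ t ≠ some (.act p' (.invoke o') r') := by
    intro t p' o' r' h
    rcases hev₂ t with h' | ⟨_, _, _, h', hi⟩ <;> rw [h] at h' <;> cases h'
    cases hi
  let σ := run.execution
  have hσ : σ.history = hist ev := rfl
  have solo : σ.history.Solo l₁.length p o := by
    intro t p' o'
    rcases cases₂ t with ⟨t', rfl, ht⟩ | ⟨rfl, ht⟩ | ⟨ht', ht⟩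
    · refine iff_of_false (not_invokes_hist (fun p' o' r' => ?_) p' o') (by rintro ⟨h, -⟩; omega)
      change ev _ ≠ _
      rw [ht]
      exact no_op₂ _ _ _ _
    · rw [hσ, invokes_hist ht]
      simp
    · refine iff_of_false (not_invokes_hist (fun p' o' r' h => ?_) p' o') (by rintro ⟨h, -⟩; omega)
      rw [show ev t = _ from h] at ht
      rcases List.mem_append.1 ht with ht | ht
      · rcases hl₀ _ ht with h' | ⟨_, _, _, h', hi⟩ <;> cases h'
        cases hi
      · rcases hlf _ ht with ⟨_, _, h'⟩ | ⟨_, _, _, h'⟩ <;> cases h'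
  have compliant : σ.Compliant f := by
    -- Every event that is not an action comes from `lf`.
    have fails : ∀ t e, ev t = some e → (∀ p i r, e ≠ .act p i r) → some e ∈ lf := by
      intro t e h he
      rcases cases₂ t with ⟨t', rfl, ht⟩ | ⟨rfl, ht⟩ | ⟨-, ht⟩
      · rcases hev₂ t' with h' | ⟨_, _, _, h', -⟩ <;> rw [← ht, h] at h' <;> cases h'
        exact absurd rfl (he _ _ _)
      · rw [h] at ht
        cases ht
        exact absurd rfl (he _ _ _)
      · rw [h] at ht
        refine (List.mem_append.1 ht).resolve_left fun ht => ?_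
        rcases hl₀ _ ht with h' | ⟨_, _, _, h', -⟩ <;> cases h'
        exact he _ _ _ rfl
    constructor
    · intro t q h
      rcases hlf _ (fails t _ h (by simp)) with ⟨_, h, h'⟩ | ⟨_, _, _, h'⟩ <;> cases h'
      exact h
    · intro t q q' h
      rcases hlf _ (fails t _ h (by simp)) with ⟨_, _, h'⟩ | ⟨_, _, h, h'⟩ <;> cases h'
      exact h
  have alive : ∀ q, σ.Correct q → q ∉ (cf.fire p (.invoke o) s₁ out₁).crashed := by
    intro q hq h
    rw [← run₂.1, ← conf_add] at h
    obtain ⟨t, ht⟩ := σ.exists_crash h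
    exact hq t ht
  have fair : σ.Fair := by
    intro q hq t
    obtain ⟨t', ht', r, h⟩ := htick₂ q (alive q hq) t
    exact ⟨l₁.length + (t' + 1), by omega, r, by rw [← h, ← ev₁_succ, ← ev_add]; rfl⟩
  -- A message that is never received would stay in transit throughout the fair part, which delivers
  -- it.
  have reliable : σ.Reliable := by
    intro t q q' m hm _ hq'
    by_contra! hcon
    have mem := fun s => σ.mem_net_of_le (t' := s) hm fun s hs r => hcon s hs r
    have mem₂ : ∀ s, t ≤ s → (q, q', m) ∈ (conf₂ s).net := by
      intro s hs
      rw [← conf_add]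
      exact mem _ (by omega)
    obtain ⟨t', ht', h⟩ := hrel₂ t q q' m (mem₂ t le_rfl) (alive q' hq')
    obtain ⟨r, h⟩ := h (mem₂ t' ht')
    exact hcon (l₁.length + (t' + 1)) (by omega) r (by rw [← h, ← ev₁_succ, ← ev_add]; rfl)
  obtain ⟨t', y, hret⟩ := hA.liveness f hf σ (hO _ solo.singleShot) compliant fair reliable p hp
    _ o solo.invokes ⟨0, fun s q o' hs hi => absurd ((solo _ _ _).1 hi).1 hs⟩
  obtain ⟨d, rfl⟩ : ∃ d, t' = l₁.length + d := by
    obtain ⟨_, _, -, h, -⟩ := hret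
    exact Nat.exists_eq_add_of_le h
  have hist_eq : ∀ s ≤ d, listHist ((List.range (d + 1)).map ev₁) s = σ.history (l₁.length + s) := by
    intro s hs
    refine hist_congr ?_
    change _ = ev _
    rw [ev_add]
    simp [prepend, show s < d + 1 by omega]
  -- The list runs from the invocation up to and including the instant `d` of the return; the full
  -- history serves as the safe solo history.
  refine ⟨cf, (List.range (d + 1)).map ev₁, _, y, d, state_f, net_f, crashed_f.ge,
    by rw [down_f]; exact Set.subset_union_right, run₁.run _, by simp, ?_, ?_, σ.history, _, _,
    hA.safety σ (hO _ solo.singleShot), solo, hret⟩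
  · intro s p' o'
    rcases le_or_gt s d with hs | hs
    · rw [invokes_congr (hist_eq s hs), solo]
      simp
    · refine iff_of_false (not_invokes_hist (fun _ _ _ => ?_) _ _) (by rintro ⟨h, -⟩; omega)
      simp [prepend, show ¬ s < d + 1 by omega]
  · obtain ⟨p', o', hi, -, ⟨e, he, hr⟩, hn⟩ := hret
    refine ⟨p', o', (invokes_congr (hist_eq 0 (by omega)) _ _).2 hi, by omega,
      ⟨e, (hist_eq d le_rfl).trans he, hr⟩, ?_⟩
    rintro s - hs r' ⟨e', he', hr'⟩
    exact hn (l₁.length + s) (by omega) (by omega) r' ⟨e', (hist_eq s hs.le).symm.trans he', hr'⟩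

end Algorithm

/-! ## Operations that conflict when one of them misses the other -/

/-- In no history of the object, `q` can first execute `o` and then `p` execute `o'`, with the
responses that the two operations return when they run solo. -/
def ObjectSpec.Conflict {Proc : Type u} {Op : Type v} {Resp : Type v'}
    (O : ObjectSpec Proc Op Resp) (q : Proc) (o : Op) (p : Proc) (o' : Op) : Prop :=
  ∀ (h₁ h₂ h : History Proc Op Resp) (a₁ s₁ a₂ s₂ a s a' s' : ℕ) (y y' : Resp),
    O.safety h₁ → h₁.Solo a₁ q o → h₁.Returns a₁ s₁ y →
    O.safety h₂ → h₂.Solo a₂ p o' → h₂.Returns a₂ s₂ y' →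
    O.safety h → (∀ t r x, h.Invokes t r x ↔ (t = a ∧ r = q ∧ x = o) ∨ (t = a' ∧ r = p ∧ x = o')) →
    h.Returns a s y → s < a' → h.Returns a' s' y' → False

/-! ### Conflicts for registers and snapshots -/

section ReadWrite

variable {Proc : Type u} {Value : Type v} {Resp : Type v'}

theorem LastWritten.eq_initial {S : Set Proc} {x₀ x : Value}
    {π : SeqExec Proc (RWOp Value) Resp} {i : ℕ} (h : LastWritten S x₀ π i x)
    (hπ : ∀ j b, π j = some b → ∀ z, b.op ≠ .write z) : x = x₀ := by
  rcases h with ⟨j, _, b, hb, _, ho, -⟩ | ⟨rfl, -⟩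
  · exact absurd ho (hπ j b hb x)
  · rfl

theorem LastWritten.eq_of_forall_write {S : Set Proc} {x₀ x y : Value}
    {π : SeqExec Proc (RWOp Value) Resp} {i : ℕ} (h : LastWritten S x₀ π i x)
    (hπ : ∀ j b, π j = some b → ∀ z, b.op = .write z → z = y)
    (hw : ∃ j < i, ∃ b, π j = some b ∧ b.IsWriteBy S) : x = y := by
  rcases h with ⟨j, _, b, hb, _, ho, -⟩ | ⟨-, h⟩
  · exact hπ j b hb x ho
  · obtain ⟨j, hj, b, hb, hbw⟩ := hw
    exact absurd hbw (h j hj b hb)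

/-- A read that runs solo returns the initial value of every part `S i` of the object; a read that
follows the only write returns what was written. -/
theorem conflict_of_linearizable {α ι : Type*} {correct : SeqExec Proc (RWOp Value) (RWResp α) → Prop}
    {usage : History Proc (RWOp Value) (RWResp α) → Prop} (S : ι → Set Proc) (x₀ : ι → Value)
    (get : α → ι → Value)
    (hc : ∀ π, correct π → ∀ i a, π i = some a → a.op = .read →
      ∃ x, a.resp = .val x ∧ ∀ k, LastWritten (S k) (x₀ k) π i (get x k))
    {q : Proc} {k : ι} (hq : q ∈ S k) {x : Value} (hx : x ≠ x₀ k) (p : Proc) :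
    (ObjectSpec.mk usage (Linearizable correct)).Conflict q (.write x) p .read := by
  intro _ h₂ h _ _ a₂ s₂ a s a' s' _ y' _ _ _ safe₂ solo₂ ret₂ safe inv ret hs ret'
  -- A linearization of the solo history contains nothing but reads.
  have solo_value : ∃ z, y' = .val z ∧ get z k = x₀ k := by
    obtain ⟨π, h1, h2, -, -, hπ⟩ := safe₂
    obtain ⟨i, b, hb, rfl⟩ := h2 _ _ _ ret₂
    have op : ∀ j d, π j = some d → d.op = .read := fun j d hd =>
      ((solo₂ _ _ _).1 (h1 j d hd).1).2.2
    obtain ⟨z, hz, hl⟩ := hc π hπ i b hb (op i b hb)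
    exact ⟨z, ((h1 i b hb).2 _ _ ret₂).symm.trans hz,
      (hl k).eq_initial fun j d hd z hz => by simp [op j d hd] at hz⟩
  -- The write returns before the read is invoked, so it comes earlier in the linearization, and
  -- every write in it has value `x`.
  have later_value : ∃ z, y' = .val z ∧ get z k = x := by
    obtain ⟨π, h1, h2, -, h4, hπ⟩ := safe
    obtain ⟨i, b, hb, rfl⟩ := h2 _ _ _ ret'
    obtain ⟨j, d, hd, rfl⟩ := h2 _ _ _ ret
    have le : d.time ≤ s := by
      obtain ⟨_, _, -, h, -⟩ := ret
      exact h
    have hbr : b.op = .read := by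
      rcases (inv _ _ _).1 (h1 i b hb).1 with ⟨h, -⟩ | ⟨-, -, h⟩
      · omega
      · exact h
    have hdw : d.proc = q ∧ d.op = .write x := by
      rcases (inv _ _ _).1 (h1 j d hd).1 with ⟨-, h⟩ | ⟨h, -⟩
      · exact h
      · omega
    obtain ⟨z, hz, hl⟩ := hc π hπ i b hb hbr
    refine ⟨z, ((h1 i b hb).2 _ _ ret').symm.trans hz, (hl k).eq_of_forall_write ?_ ?_⟩
    · intro j d hd z hz
      rcases (inv _ _ _).1 (h1 j d hd).1 with ⟨-, -, h⟩ | ⟨-, -, h⟩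
      · rw [hz] at h
        cases h
        rfl
      · rw [hz] at h
        cases h
    · exact ⟨j, h4 j i d b hd hb ⟨s, _, ret, hs⟩, d, hd, hdw.1 ▸ hq, x, hdw.2⟩
  obtain ⟨z, rfl, hz⟩ := solo_value
  obtain ⟨_, h, hz'⟩ := later_value
  cases h
  exact hx (hz'.symm.trans hz)

theorem atomicRegister_conflict {x₀ x : Value} (hx : x ≠ x₀) (q p : Proc) :
    (atomicRegister Proc x₀).Conflict q (.write x) p .read :=
  conflict_of_linearizable (fun _ : Unit => Set.univ) (fun _ => x₀) (fun z _ => z)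
    (fun π hπ i a ha hr => by
      obtain ⟨z, hz, hl⟩ := (hπ i a ha).2 hr
      exact ⟨z, hz, fun _ => hl⟩)
    (k := ()) (Set.mem_univ q) hx p

theorem atomicSnapshot_conflict {s₀ : Proc → Value} {q : Proc} {x : Value} (hx : x ≠ s₀ q)
    (p : Proc) : (atomicSnapshot s₀).Conflict q (.write x) p .read :=
  conflict_of_linearizable (fun r => {r}) s₀ (fun z => z) (fun _ hπ i a ha => (hπ i a ha).2)
    (Set.mem_singleton q) hx p

end ReadWrite

/-- Upward and downward validity force a solo proposal to return its own input, so the two responses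
would be incomparable. -/
theorem latticeAgreement_conflict {Proc : Type u} {L : Type v} [SemilatticeSup L] {x y : L}
    (hxy : ¬ x ≤ y) (hyx : ¬ y ≤ x) (q p : Proc) :
    (latticeAgreement Proc L).Conflict q x p y := by
  have solo {h : History Proc L L} {t s : ℕ} {r : Proc} {z z' : L} (safe : LatticeAgreementSafety h)
      (hs : h.Solo t r z) (hr : h.Returns t s z') : z' = z := by
    obtain ⟨w, hw, hz'⟩ := safe.upward _ _ _ hr
    refine (hz'.trans (hw.2 ?_)).antisymm (safe.downward _ _ _ _ _ hs.invokes hr)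
    rintro _ ⟨t', p', hi⟩
    exact ((hs _ _ _).1 hi).2.2.le
  intro h₁ h₂ h _ _ _ _ _ _ _ _ _ _ safe₁ solo₁ ret₁ safe₂ solo₂ ret₂ safe _ ret _ ret'
  obtain rfl := solo safe₁ solo₁ ret₁
  obtain rfl := solo safe₂ solo₂ ret₂
  exact (safe.comparability _ _ _ _ _ _ ret ret').elim hxy hyx

/-- All executions built in the argument are single-shot, so one argument serves every object. -/
theorem History.SingleShot.sequential {Proc : Type u} {Op : Type v} {Resp : Type v'}
    {h : History Proc Op Resp} (hs : h.SingleShot) : h.Sequential :=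
  fun p t t' o o' hlt hi hi' => absurd (hs p t t' o o' hi hi') hlt.ne

/-! ## Ancestors and components in the residual graph -/

namespace FailurePattern

variable {Proc : Type u} (f : FailurePattern Proc)

/-- The processes from which `p` can be reached. -/
def ancestors (p : Proc) : Set Proc := {r | f.Reach r p}

/-- The strongly connected component of `p`. -/
def scc (p : Proc) : Set Proc := {r | f.Reach p r ∧ f.Reach r p}

variable {f}

theorem Reach.correct_left {p q : Proc} (h : f.Reach p q) (hq : q ∉ f.procs) : p ∉ f.procs := by
  rcases Relation.ReflTransGen.cases_head h with rfl | ⟨_, h, -⟩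
  · exact hq
  · exact h.1

theorem Reach.correct_right {p q : Proc} (h : f.Reach p q) (hp : p ∉ f.procs) : q ∉ f.procs := by
  rcases Relation.ReflTransGen.cases_tail h with rfl | ⟨_, -, h⟩
  · exact hp
  · exact h.2.1

/-- Once everything listed in `f` has failed, a set of correct processes that is closed under
predecessors in the residual graph is isolated. -/
theorem isolated {Op : Type v} {Resp : Type v'} {A : Algorithm.{u, v, v', w} Proc Op Resp}
    {c : A.Config} (hP : f.procs ⊆ c.crashed) (hC : f.chans ⊆ c.down) {S : Set Proc}
    (hS : ∀ r ∈ S, r ∉ f.procs) (h : ∀ s, ∀ r ∈ S, f.Edge s r → s ∈ S) :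
    Algorithm.Isolated c S := by
  intro s hs r hr
  by_contra! hcon
  exact hs (h s r hr ⟨fun h => hcon.1 (hP h), hS r hr, fun h => hcon.2 (hC h)⟩)

end FailurePattern

/-! ## Lower bound -/

namespace Algorithm

variable {Proc : Type u} {Op : Type v} {Resp : Type v'} {A : Algorithm.{u, v, v', w} Proc Op Resp}

/-- Erased events become idle instants rather than being deleted, so the remaining ones keep their
times. -/
theorem hist_map_restrict {Msg : Type w} {S : Set Proc}
    {l : List (Option (Event Proc Op Resp Msg))} {t : ℕ} {e : HistEntry Proc Op Resp} :
    listHist (l.map (restrict S)) t = some e ↔ listHist l t = some e ∧ e.proc ∈ S := by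
  classical
  have key : ∀ a : Option (Event Proc Op Resp Msg),
      (restrict S a).bind Event.entry = some e ↔ a.bind Event.entry = some e ∧ e.proc ∈ S := by
    rintro (_ | ⟨p, i, r⟩ | _ | _)
    · simp [restrict]
    · by_cases hp : p ∈ S
      · simp only [restrict, if_pos hp, iff_self_and]
        rintro ⟨⟩
        exact hp
      · simp only [restrict, if_neg hp]
        refine iff_of_false (by simp) ?_
        rintro ⟨⟨⟩, h⟩
        exact hp h
    · simp [restrict, Event.entry]
    · simp [restrict, Event.entry]
  have : prepend (l.map (restrict S)) (fun _ => none) t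
      = restrict S (prepend l (fun _ => none) t) := by
    simp only [prepend, List.getElem?_map]
    cases l[t]? <;> rfl
  change (prepend (l.map (restrict S)) (fun _ => none) t).bind Event.entry = some e ↔ _
  rw [this]
  exact key _

theorem invokes_map_restrict {Msg : Type w} {S : Set Proc}
    {l : List (Option (Event Proc Op Resp Msg))} {t : ℕ} {p : Proc} {o : Op} :
    (listHist (l.map (restrict S))).Invokes t p o ↔ (listHist l).Invokes t p o ∧ p ∈ S := by
  simp only [History.Invokes, hist_map_restrict]
  grind

theorem responds_map_restrict {Msg : Type w} {S : Set Proc}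
    {l : List (Option (Event Proc Op Resp Msg))} {t : ℕ} {p : Proc} {y : Resp} :
    (listHist (l.map (restrict S))).Responds t p y ↔ (listHist l).Responds t p y ∧ p ∈ S := by
  simp only [History.Responds, hist_map_restrict]
  grind

theorem solo_map_restrict {Msg : Type w} {S : Set Proc}
    {l : List (Option (Event Proc Op Resp Msg))} {t : ℕ} {p : Proc} {o : Op} (hp : p ∈ S)
    (h : (listHist l).Solo t p o) : (listHist (l.map (restrict S))).Solo t p o := by
  intro t' p' o'
  rw [invokes_map_restrict, h, and_iff_left_iff_imp]
  rintro ⟨-, rfl, -⟩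
  exact hp

theorem returns_map_restrict {Msg : Type w} {S : Set Proc}
    {l : List (Option (Event Proc Op Resp Msg))} {t t' : ℕ} {p : Proc} {o : Op} {y : Resp}
    (hp : p ∈ S) (hs : (listHist l).Solo t p o) (h : (listHist l).Returns t t' y) :
    (listHist (l.map (restrict S))).Returns t t' y := by
  obtain ⟨p', o', hi, ht, hr, hn⟩ := h
  obtain ⟨-, rfl, rfl⟩ := (hs _ _ _).1 hi
  exact ⟨p', o', invokes_map_restrict.2 ⟨hi, hp⟩, ht, responds_map_restrict.2 ⟨hr, hp⟩,
    fun s h₁ h₂ r' hr' => hn s h₁ h₂ r' (responds_map_restrict.1 hr').1⟩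

/-- If `o` by `q` and `o'` by `p` conflict, then some process that can reach `p` under `f` is
strongly connected with `q` under `g`. -/
theorem Implements.ancestors_inter_scc [Finite Proc] {O : ObjectSpec Proc Op Resp}
    {F : Set (FailurePattern Proc)} {τ : FailurePattern Proc → Set Proc} (hA : A.Implements O F τ)
    (hτ : ∀ f ∈ F, τ f ⊆ f.procsᶜ)
    (hO : ∀ h : History Proc Op Resp, h.SingleShot → O.usage h)
    {f g : FailurePattern Proc} (hf : f ∈ F) (hg : g ∈ F) {p q : Proc} (hp : p ∈ τ f)
    (hq : q ∈ τ g) {o o' : Op} (hconf : O.Conflict q o p o') :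
    (f.ancestors p ∩ g.scc q).Nonempty := by
  classical
  by_contra hne
  have disj : ∀ r, f.Reach r p → r ∉ g.scc q := fun r h h' => hne ⟨r, h, h'⟩
  have hpf := hτ f hf hp
  have hqg := hτ g hg hq
  have q_scc : q ∈ g.scc q := ⟨.refl, .refl⟩
  have hpq : p ≠ q := fun h => disj p .refl (h ▸ q_scc)
  set S := g.ancestors q
  -- `B` is the part of the past of `q` that the ancestors of `p` may share.
  set B := S \ g.scc q
  set Rf := f.ancestors p
  have hBS : B ⊆ S := Set.sdiff_subset
  have scc_of : ∀ r, r ∈ S \ B → r ∈ g.scc q := fun r h => by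
    by_contra h'
    exact h.2 ⟨h.1, h'⟩
  obtain ⟨cg, la, c₁, y, n, state_g, net_g, crashed_g, down_g, run_a, len_a, solo_a, ret_a,
    h₁, a₁, s₁, safe₁, solo₁, ret₁⟩ :=
    hA.exists_solo hO hg hq hqg o (.nil _) rfl (by simp)
  have pred_S : ∀ s, ∀ r ∈ S, g.Edge s r → s ∈ S := fun s r hr he => .head he hr
  have isoS : Isolated cg S :=
    FailurePattern.isolated crashed_g down_g (fun r hr => FailurePattern.Reach.correct_left hr hqg)
      pred_S
  have isoB : Isolated cg B := by
    refine FailurePattern.isolated crashed_g down_g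
      (fun r hr => FailurePattern.Reach.correct_left hr.1 hqg) fun s r hr he => ?_
    -- A predecessor of `r` in the component of `q` would make `r` reachable from `q`, and `r`
    -- reaches `q`, so `r` would lie in the component.
    exact ⟨pred_S s r hr.1 he, fun hs => hr.2 ⟨.tail hs.1 he, hr.1⟩⟩
  have rep₀ : Replays S B cg A.initial A.initial :=
    ⟨rfl, rfl, rfl, rfl, fun _ _ => by rw [state_g], fun _ _ => rfl, fun _ _ => by rw [net_g],
      fun _ _ => by rw [net_g], fun _ _ => le_rfl, isoS, isoB⟩
  obtain ⟨m₁, e₁, run_m₁, run_e₁, rep₁⟩ := rep₀.run hBS run_a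
  -- The only invocation in `la` is by `q`, which is not in `B`.
  have quiet : ∀ e ∈ la.map (restrict B), e = none ∨
      ∃ p i r, e = some (.act p i r) ∧ i.op? = none := by
    intro e he
    obtain ⟨t, ht⟩ := List.mem_iff_getElem?.1 he
    have ht' : prepend (la.map (restrict B)) (fun _ => none) t = e := by simp [prepend, ht]
    rcases e with _ | ⟨r, i, z⟩ | r | ⟨r, r'⟩
    · exact .inl rfl
    · refine .inr ⟨r, i, z, rfl, ?_⟩
      cases i with
      | invoke x =>
        obtain ⟨hi, hB⟩ := invokes_map_restrict.1 ((invokes_hist ht' r x).2 ⟨rfl, rfl⟩)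
        obtain ⟨-, rfl, -⟩ := (solo_a _ _ _).1 hi
        exact absurd q_scc hB.2
      | _ => rfl
    all_goals
      obtain ⟨a, -, ha⟩ := List.mem_map.1 he
      rcases a with _ | ⟨_, _, _⟩ | _ | _ <;> simp [restrict] at ha
  -- The operation of `p` starts from `e₁`, where the component of `q` has never acted.
  obtain ⟨cf, lb, c₂, y', n', state_f, net_f, crashed_f, down_f, run_b, len_b, solo_b, ret_b,
    h₂, a₂, s₂, safe₂, solo₂, ret₂⟩ :=
    hA.exists_solo hO hf hp hpf o' run_e₁ rep₁.crashed_right quiet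
  have isoRf : Isolated cf Rf :=
    FailurePattern.isolated crashed_f down_f (fun r hr => FailurePattern.Reach.correct_left hr hpf)
      fun s r hr he => .head he hr
  -- This moves the run of `p` from `e₁` to `m₁`: on `Rf` the states agree, and `m₁` has all the
  -- messages needed. The second replay is a dummy, with no process to act in it.
  have rep₂ : Replays Rf ∅ cf m₁ { m₁ with net := 0 } :=
    ⟨rep₁.crashed_left, rep₁.down_left, rep₁.crashed_left, rep₁.down_left,
      fun r hr => by
        rw [state_f, rep₁.state_right r fun h => disj r hr (scc_of r h)],
      fun _ _ => rfl,
      fun x hx => by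
        rw [net_f]
        exact rep₁.net_le x fun h => disj _ hx (scc_of _ h),
      fun _ h => absurd h (Set.notMem_empty _), fun _ _ => by simp, isoRf,
      fun _ _ _ h => absurd h (Set.notMem_empty _)⟩
  obtain ⟨m₂, -, run_m₂, -, -⟩ := rep₂.run (Set.empty_subset _) run_b
  obtain ⟨conf, run, -⟩ := (run_m₁.append run_m₂).prepend (isRun_const m₂)
  set la' := la.map (restrict S)
  set lb' := lb.map (restrict Rf)
  have len_a' : la'.length = n + 1 := by simp [la', len_a]
  have solo_a' : (listHist la').Solo 0 q o := solo_map_restrict .refl solo_a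
  have solo_b' : (listHist lb').Solo 0 p o' := solo_map_restrict .refl solo_b
  have ret_a' : (listHist la').Returns 0 n y := returns_map_restrict .refl solo_a ret_a
  have ret_b' : (listHist lb').Returns 0 n' y' := returns_map_restrict .refl solo_b ret_b
  -- `la'` has `n + 1` entries: `o` returns at instant `n`, and `o'` is invoked at instant `n + 1`.
  have left : ∀ t, t ≤ n → listHist (la' ++ lb') t = listHist la' t := fun t ht =>
    hist_congr (prepend_append_left _ (by omega))
  have right : ∀ t, listHist (la' ++ lb') (n + 1 + t) = listHist lb' t := fun t =>
    hist_congr (by rw [← len_a']; exact prepend_append_right _ _ _ _)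
  have inv : ∀ t r x, (listHist (la' ++ lb')).Invokes t r x ↔
      (t = 0 ∧ r = q ∧ x = o) ∨ (t = n + 1 ∧ r = p ∧ x = o') := by
    intro t r x
    rcases le_or_gt t n with ht | ht
    · rw [invokes_congr (left t ht), solo_a']
      have : t ≠ n + 1 := by omega
      simp [this]
    · obtain ⟨d, rfl⟩ := Nat.exists_eq_add_of_le (Nat.succ_le_of_lt ht)
      rw [Nat.succ_eq_add_one, invokes_congr (right d), solo_b']
      simp
  have single : (listHist (la' ++ lb')).SingleShot := by
    intro r t t' x x' hi hi'
    rw [inv] at hi hi'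
    grind
  refine hconf h₁ h₂ (listHist (la' ++ lb')) a₁ s₁ a₂ s₂ 0 n (n + 1) (n + 1 + n') y y' safe₁ solo₁ ret₁ safe₂ solo₂ ret₂
    (hA.safety run.execution (hO _ single)) inv ?_ (Nat.lt_succ_self n) ?_
  · simpa using ret_a'.shift (h' := listHist (la' ++ lb')) (n := 0) fun s _ hs => by
      rw [zero_add, left s hs]
  · simpa using ret_b'.shift (h' := listHist (la' ++ lb')) (n := n + 1) fun s _ _ => right s

/-- An object with conflicting operations for any two processes can only be implemented if there is
a generalized quorum system. -/
theorem Implements.exists_isGQS [Finite Proc] {O : ObjectSpec Proc Op Resp}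
    {F : Set (FailurePattern Proc)} {τ : FailurePattern Proc → Set Proc} (hA : A.Implements O F τ)
    (hτ : ∀ f ∈ F, τ f ⊆ f.procsᶜ) (hne : ∀ f ∈ F, (τ f).Nonempty)
    (hO : ∀ h : History Proc Op Resp, h.SingleShot → O.usage h)
    (hconf : ∀ q p, ∃ o o', O.Conflict q o p o') :
    ∃ Rs Ws : Set (Set Proc), IsGQS F Rs Ws ∧ ∀ f ∈ F, τ f ⊆ f.component Rs Ws := by
  have avail : ∀ f ∈ F, ∀ p ∈ τ f,
      f.Available (f.scc p) ∧ f.ReachableFrom (f.scc p) (f.ancestors p) := by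
    intro f hf p hp
    have hpf := hτ f hf hp
    have hW : f.scc p ⊆ f.procsᶜ := fun r hr => FailurePattern.Reach.correct_right hr.1 hpf
    exact ⟨⟨hW, fun r hr s hs => hr.2.trans hs.1⟩, hW,
      fun r hr => FailurePattern.Reach.correct_left hr hpf, fun r hr s hs => .trans hr hs.1⟩
  -- Every `p ∈ τ f` contributes its quorums, not just one per `f`; this is what places all of `τ f`
  -- in the component.
  refine ⟨{R | ∃ f ∈ F, ∃ p ∈ τ f, R = f.ancestors p}, {W | ∃ f ∈ F, ∃ p ∈ τ f, W = f.scc p},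
    ⟨?_, ?_⟩, ?_⟩
  · rintro _ ⟨f, hf, p, hp, rfl⟩ _ ⟨g, hg, q, hq, rfl⟩
    obtain ⟨o, o', h⟩ := hconf q p
    exact hA.ancestors_inter_scc hτ hO hf hg hp hq h
  · intro f hf
    obtain ⟨p, hp⟩ := hne f hf
    exact ⟨_, ⟨f, hf, p, hp, rfl⟩, _, ⟨f, hf, p, hp, rfl⟩, avail f hf p hp⟩
  · intro f hf p hp
    have h := avail f hf p hp
    exact ⟨p, ⟨f.scc p, ⟨⟨f, hf, p, hp, rfl⟩, h.1, _, ⟨f, hf, p, hp, rfl⟩, h.2⟩, .refl, .refl⟩,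
      .refl, .refl⟩

end Algorithm

/-! ### The three objects -/

theorem theorem4p2 {Proc : Type u} [Finite Proc]
    {Value : Type v} [Nontrivial Value] (x₀ : Value) (s₀ : Proc → Value)
    {L : Type v'} [SemilatticeSup L] (hL : ∃ x y : L, ¬ x ≤ y ∧ ¬ y ≤ x)
    (F : Set (FailurePattern Proc)) (τ : FailurePattern Proc → Set Proc)
    (hτ : ∀ f ∈ F, τ f ⊆ f.procsᶜ) (hne : ∀ f ∈ F, (τ f).Nonempty)
    (h : (∃ A : Algorithm.{u, v, v, w} Proc (RWOp Value) (RWResp Value),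
            A.Implements (atomicRegister Proc x₀) F τ) ∨
         (∃ A : Algorithm.{u, v, max u v, w} Proc (RWOp Value) (RWResp (Proc → Value)),
            A.Implements (atomicSnapshot s₀) F τ) ∨
         (∃ A : Algorithm.{u, v', v', w} Proc L L,
            A.Implements (latticeAgreement Proc L) F τ)) :
    ∃ Rs Ws : Set (Set Proc), IsGQS F Rs Ws ∧ ∀ f ∈ F, τ f ⊆ f.component Rs Ws := by

  rcases h with ⟨A, hA⟩ | ⟨A, hA⟩ | ⟨A, hA⟩
  · obtain ⟨x, hx⟩ := exists_ne x₀
    exact hA.exists_isGQS hτ hne (fun _ => History.SingleShot.sequential) fun q p =>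
      ⟨_, _, atomicRegister_conflict hx q p⟩
  · refine hA.exists_isGQS hτ hne (fun _ => History.SingleShot.sequential) fun q p => ?_
    obtain ⟨x, hx⟩ := exists_ne (s₀ q)
    exact ⟨_, _, atomicSnapshot_conflict hx p⟩
  · obtain ⟨x, y, hxy, hyx⟩ := hL
    exact hA.exists_isGQS hτ hne (fun _ => id) fun q p =>
      ⟨_, _, latticeAgreement_conflict hxy hyx q p⟩
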